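/- Let $n\ge 2$. The ladder network has $2n-1$ vertices, each holding one qubit: one vertex for Alice, and two vertices for each of the other $n-1$ roles of an $n$-party game (two Bobs, two Charlies, and so on). Its hyperedge set $\mathcal E$ consists of the $2^{n-1}$ sets of $n$ vertices formed by Alice and one of the two vertices of every other role. Each $e\in\mathcal E$ stands for one $n$-party game, played by its vertices. A state $\rho$ is a density operator on the $2n-1$ qubits. An $n$-partite full-correlation Bell inequality $\mathcal I$ (two settings, two outcomes per party) is given by real coefficients $c_x$, $x\in\{1,2\}^n$, and is normalized to local bound $1$, that is, $$\max_{a}\ \sum_{x} c_x\prod_{r=1}^n a_r(x_r)=1,$$ the maximum being over all sign-valued functions $a_r:\{1,2\}\to\{-1,1\}$. If every vertex $v$ measures binary observables $A^{(v)}_1,A^{(v)}_2$ (Hermitian operators on its qubit with square $\mathbf 1$, the same in all games in which $v$ takes part) on a state $\rho$, the value on the hyperedge $e=(v_1,\dots,v_n)$ is $$\langle\mathcal I\rangle_e=\sum_x c_x\,\mathrm{Tr}\bigl[\rho\,A^{(v_1)}_{x_1}\otimes\cdots\otimes A^{(v_n)}_{x_n}\bigr],$$ with the identity acting on the qubits outside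 $e$. (i) For every such $\mathcal I$, every state $\rho$ and all binary observables, $$\sum_{e\in\mathcal E}\langle\mathcal I\rangle_e^2\le 2^{n-1},$$ and this is tight: for every such $\mathcal I$ there are a state and binary observables for which equality holds. (ii) The same holds when $\langle\mathcal I\rangle_e^2$ is read as the squared Bell parameter $\sum_{k\in\{1,2\}^n}T_{e,k}^2$ given by the correlation tensor in local measurement planes. That is, for each vertex $v$ let $\vec o^{(v)}_1,\vec o^{(v)}_2\in\mathbb R^3$ be orthonormal, and put $$T_{e,k}=\mathrm{Tr}\bigl[\rho\,(\vec o^{(v_1)}_{k_1}\!\cdot\vec\sigma)\otimes\cdots\otimes(\vec o^{(v_n)}_{k_n}\!\cdot\vec\sigma)\bigr],$$ where $\vec\sigma=(\sigma_x,\sigma_y,\sigma_z)$ are the Pauli matrices. Then $\sum_{e\in\mathcal E}\sum_k T_{e,k}^2\le 2^{n-1}$ for every state $\rho$, and for every choice of the directions some state attains equality. -/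

import Mathlib

open scoped ComplexOrder

/-- The `n` roles of an `n`-partite game: `none` is Alice, and `some i` with `i : Fin (n - 1)` are
the other roles (Bob, Charlie, ...). -/
abbrev Role (n : ℕ) : Type := Option (Fin (n - 1))

/-- The vertices of the ladder network: one Alice `none`, and two copies `some (i, 0)`,
`some (i, 1)` of every other role `i` (two Bobs, two Charlies, ...). -/
abbrev LadderVertex (n : ℕ) : Type := Option (Fin (n - 1) × Fin 2)

/-- The hyperedges of the ladder network: a hyperedge selects one of the two copies of every role
other than Alice. -/
abbrev LadderEdge (n : ℕ) : Type := Fin (n - 1) → Fin 2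

/-- The vertex that plays the role `r` in the game on the hyperedge `e`; Alice takes part in every
game. -/
def LadderEdge.player {n : ℕ} (e : LadderEdge n) : Role n → LadderVertex n
  | none => none
  | some i => some (i, e i)

theorem card_role (n : ℕ) (hn : 2 ≤ n) : Fintype.card (Role n) = n := by
  simp only [Fintype.card_option, Fintype.card_fin]; omega

theorem card_ladderVertex (n : ℕ) (hn : 2 ≤ n) : Fintype.card (LadderVertex n) = 2 * n - 1 := by
  simp only [Fintype.card_option, Fintype.card_prod, Fintype.card_fin]; omega

theorem card_ladderEdge (n : ℕ) : Fintype.card (LadderEdge n) = 2 ^ (n - 1) := by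
  simp

theorem LadderEdge.player_injective {n : ℕ} (e : LadderEdge n) :
    Function.Injective e.player := by
  rintro (_ | i) (_ | j) h <;> simp_all [LadderEdge.player]

/-- Operators on one qubit. -/
abbrev QubitOp : Type := Matrix (Fin 2) (Fin 2) ℂ

/-- Operators on the joint space of one qubit per element of `V`, in the computational basis
`V → Fin 2`. -/
abbrev NetworkOp (V : Type) : Type := Matrix (V → Fin 2) (V → Fin 2) ℂ

/-- The tensor product `⨂ v, M v` of one-qubit operators. -/
def tensorOp {V : Type} [Fintype V] (M : V → QubitOp) : NetworkOp V :=
  Matrix.of fun a b => ∏ v, M v (a v) (b v)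

/-- Density operators (mixed states). -/
def IsDensityOp {V : Type} [Fintype V] [DecidableEq V] (ρ : NetworkOp V) : Prop :=
  ρ.PosSemidef ∧ ρ.trace = 1

/-- Binary observables: Hermitian operators with eigenvalues in `{1, -1}`. -/
def IsBinaryObservable (A : QubitOp) : Prop :=
  A.IsHermitian ∧ A * A = 1

/-- The one-qubit factors of the operator `⨂ r, B r` of a hyperedge `e`: the player of role `r`
carries `B r`, and every vertex outside `e` carries the identity. -/
def edgeFactor {n : ℕ} (e : LadderEdge n) (B : Role n → QubitOp) : LadderVertex n → QubitOp
  | none => B none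
  | some (i, j) => if j = e i then B (some i) else 1

theorem edgeFactor_player {n : ℕ} (e : LadderEdge n) (B : Role n → QubitOp) (r : Role n) :
    edgeFactor e B (e.player r) = B r := by
  cases r <;> simp [edgeFactor, LadderEdge.player]

theorem edgeFactor_of_notMem {n : ℕ} (e : LadderEdge n) (B : Role n → QubitOp)
    (v : LadderVertex n) (hv : v ∉ Set.range e.player) : edgeFactor e B v = 1 := by
  rcases v with _ | ⟨i, j⟩
  · exact absurd ⟨none, rfl⟩ hv
  · have h : j ≠ e i := fun h => hv ⟨some i, by simp [LadderEdge.player, h]⟩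
    simp [edgeFactor, h]

/-- The expectation `Tr (ρ ⨂ r, B r)` of the product over the roles `r` of the operators `B r`,
where `B r` acts on the qubit of the player `e.player r`, and the identity acts on all qubits
outside the hyperedge `e`. The trace is real for Hermitian `B r`. -/
def edgeExpectation {n : ℕ} (ρ : NetworkOp (LadderVertex n)) (e : LadderEdge n)
    (B : Role n → QubitOp) : ℝ :=
  (ρ * tensorOp (edgeFactor e B)).trace.re

/-- The value `∑ x, c x * ∏ r, a r (x r)` of the full-correlation expression with coefficients `c`
at a local deterministic strategy `a`, where `a r x` is the outcome (a sign) of role `r` at the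
setting `x`. -/
def localValue {R : Type} [Fintype R] [DecidableEq R] (c : (R → Fin 2) → ℝ)
    (a : R → Fin 2 → ℤˣ) : ℝ :=
  ∑ x, c x * ∏ r, ((a r (x r) : ℤ) : ℝ)

/-- The full-correlation Bell inequality `∑ x, c x * E x ≤ 1` is normalized: its local (classical)
bound, the largest value of a local deterministic strategy, equals `1`. -/
def IsNormalizedBell {R : Type} [Fintype R] [DecidableEq R] (c : (R → Fin 2) → ℝ) : Prop :=
  IsGreatest (Set.range (localValue c)) 1

/-- The value `⟨I⟩_e = ∑ x, c x * E_e x` on the hyperedge `e` when the state is `ρ` and the vertex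
`v` measures the observable `A v x` at the setting `x`. -/
noncomputable def bellValue {n : ℕ} (c : (Role n → Fin 2) → ℝ) (ρ : NetworkOp (LadderVertex n))
    (A : LadderVertex n → Fin 2 → QubitOp) (e : LadderEdge n) : ℝ :=
  ∑ x, c x * edgeExpectation ρ e fun r => A (e.player r) (x r)

/-- The spin observable `u · σ = u₀ σ_x + u₁ σ_y + u₂ σ_z`. -/
noncomputable def spinObservable (u : EuclideanSpace ℝ (Fin 3)) : QubitOp :=
  (u 0 : ℂ) • !![0, 1; 1, 0] + (u 1 : ℂ) • !![0, -Complex.I; Complex.I, 0] +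
    (u 2 : ℂ) • !![1, 0; 0, -1]

/-- The sum `∑ k, T_k ^ 2` of the squared elements of the correlation tensor of the players of the
hyperedge `e`, where the vertex `v` uses the two directions `o v 0`, `o v 1`. -/
noncomputable def correlationSq {n : ℕ} (ρ : NetworkOp (LadderVertex n))
    (o : LadderVertex n → Fin 2 → EuclideanSpace ℝ (Fin 3)) (e : LadderEdge n) : ℝ :=
  ∑ k : Role n → Fin 2,
    edgeExpectation ρ e (fun r => spinObservable (o (e.player r) (k r))) ^ 2

/-!
Everything rests on one inequality for the correlation tensors in the `σ_x σ_y`-planes,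
`sum_sq_edgeExpectation_pauli_le`. In the computational basis, `σ_x` and `σ_y` flip a bit, so by
Parseval's identity the squared correlation tensor of a hyperedge `e` is `2 ^ n` times
`∑ s, ‖coherence ρ e s‖ ^ 2`, where `coherence ρ e s` sums the entries of `ρ` between basis states
that differ exactly on the players of `e`, whose bits are `s` in the first of them. Split this sum
by the parities `p` of the two bits of every role other than Alice. Flipping one of the two bits of
each role reverses all parities, and a pair of basis states with Alice's bits `t`, `t + 1` and the
parities `p`, `p + 1` determines the hyperedge and the bits of its players: the two states differ in
exactly one of the two bits of each role (`sum_edge_pairs`). Hence, for fixed `t` and `p`, the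
entries of `ρ` that occur for all `e` and `s` are those of a whole block, each once, and since
`‖ρ a b‖ ^ 2 ≤ ρ a a * ρ b b` their `ℓ²`-norm is at most the geometric mean of the probabilities
`m t p` and `m (t + 1) (p + 1)` of the two classes of basis states. Minkowski's inequality over `p`
and the Cauchy–Schwarz inequality bound the total by `2 * M 0 * M 1 ≤ (M 0 + M 1) ^ 2 / 2`, where
`M t` is the probability of Alice's bit `t`.

Arbitrary orthonormal directions are reduced to `σ_x`, `σ_y` by local unitaries
(`exists_unitary_spinObservable`), and a GHZ state on one hyperedge saturates the inequality.

For a Bell expression, two spin observables of a vertex have the form `q 0 • σ_x ± q 1 • σ_y` in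
suitable axes, because the sum and the difference of two unit vectors are orthogonal. The Bell value
is then a linear form in the correlation tensor with coefficients `ĉ k * ∏ r, q r (k r)`, where the
Walsh coefficients `ĉ k` of `c` are values of local deterministic strategies up to a sign, so
`|ĉ k| ≤ 1`, and the Cauchy–Schwarz inequality applies (`sq_bellValue_planar_le`). Observables `1`
and `-1` are not spin observables; a vertex that uses one of them is decomposed into two branches in
which the outcomes are deterministic (`exists_kraus_planar`), and Minkowski's inequality over the
branches gives the bound for the original state (`sum_sq_bellValue_le`). A product state with an
optimal deterministic strategy saturates it.
-/

/-! ### Product operators and Kraus decompositions -/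

section TensorOp

variable {V : Type} [Fintype V]

theorem tensorOp_mul [DecidableEq V] (M N : V → QubitOp) :
    tensorOp M * tensorOp N = tensorOp fun v => M v * N v := by
  ext a b
  simp only [tensorOp, Matrix.mul_apply, Matrix.of_apply, Finset.prod_univ_sum,
    Fintype.piFinset_univ, Finset.prod_mul_distrib]

theorem tensorOp_one : tensorOp (fun _ : V => (1 : QubitOp)) = 1 := by
  ext a b
  simp only [tensorOp, Matrix.of_apply, Matrix.one_apply, Finset.prod_ite_zero, funext_iff,
    Finset.mem_univ, true_imp_iff, Finset.prod_const_one]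

theorem conjTranspose_tensorOp (M : V → QubitOp) :
    (tensorOp M).conjTranspose = tensorOp fun v => (M v).conjTranspose := by
  ext a b
  simp [tensorOp, Matrix.conjTranspose_apply]

theorem tensorOp_sum [DecidableEq V] {β : Type} [Fintype β] (M : V → β → QubitOp) :
    tensorOp (fun v => ∑ b, M v b) = ∑ b : V → β, tensorOp fun v => M v (b v) := by
  ext a b
  simp only [tensorOp, Matrix.of_apply, Matrix.sum_apply, Finset.prod_univ_sum,
    Fintype.piFinset_univ]

end TensorOp

section Edge

variable {n : ℕ}

theorem tensorOp_edgeFactor_apply (e : LadderEdge n) (B : Role n → QubitOp)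
    (a b : LadderVertex n → Fin 2) :
    tensorOp (edgeFactor e B) a b = (∏ r, B r (a (e.player r)) (b (e.player r))) *
      ∏ i, if a (some (i, e i + 1)) = b (some (i, e i + 1)) then 1 else 0 := by
  simp only [tensorOp, Matrix.of_apply, Fintype.prod_option, edgeFactor, LadderEdge.player,
    Fintype.prod_prod_type, mul_assoc, ← Finset.prod_mul_distrib]
  congr 1
  refine Finset.prod_congr rfl fun i _ => ?_
  obtain h | h : e i = 0 ∨ e i = 1 := by omega
  · simp [h, Matrix.one_apply]
  · simp [h, Matrix.one_apply]

theorem edgeExpectation_sum_smul (ρ : NetworkOp (LadderVertex n)) (e : LadderEdge n)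
    (w : Role n → Fin 2 → ℝ) (P : Fin 2 → QubitOp) :
    edgeExpectation ρ e (fun r => ∑ k, (w r k : ℂ) • P k) =
      ∑ k : Role n → Fin 2, (∏ r, w r (k r)) * edgeExpectation ρ e fun r => P (k r) := by
  have h : tensorOp (edgeFactor e fun r => ∑ k, (w r k : ℂ) • P k) =
      ∑ k : Role n → Fin 2, ((∏ r, w r (k r) : ℝ) : ℂ) •
        tensorOp (edgeFactor e fun r => P (k r)) := by
    ext a b
    simp only [Matrix.sum_apply, Matrix.smul_apply, tensorOp_edgeFactor_apply, smul_eq_mul,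
      Finset.prod_univ_sum, Fintype.piFinset_univ, Finset.sum_mul, Finset.prod_mul_distrib,
      Complex.ofReal_prod, mul_assoc]
  simp only [edgeExpectation, h, Finset.mul_sum, Matrix.mul_smul, Matrix.trace_sum,
    Matrix.trace_smul, Complex.re_sum, smul_eq_mul, Complex.re_ofReal_mul]

theorem edgeFactor_kraus {β : Type} [Fintype β] (K : LadderVertex n → β → QubitOp)
    (hK : ∀ v, ∑ b, (K v b).conjTranspose * K v b = 1)
    (e : LadderEdge n) (B : Role n → QubitOp) (B' : Role n → β → QubitOp)
    (hB : ∀ r, B r =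
      ∑ b, (K (e.player r) b).conjTranspose * B' r b * K (e.player r) b) :
    tensorOp (edgeFactor e B) = ∑ b : LadderVertex n → β,
      (tensorOp fun v => K v (b v)).conjTranspose *
        tensorOp (edgeFactor e fun r => B' r (b (e.player r))) * tensorOp fun v => K v (b v) := by
  have h : edgeFactor e B = fun v => ∑ b, (K v b).conjTranspose *
      edgeFactor e (fun r => B' r b) v * K v b := by
    funext v
    rcases v with _ | ⟨i, j⟩
    · exact hB none
    · by_cases hj : j = e i
      · subst hj; simpa [edgeFactor, LadderEdge.player] using hB (some i)
      · simpa [edgeFactor, hj] using (hK (some (i, j))).symm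
  rw [h, tensorOp_sum]
  refine Finset.sum_congr rfl fun b _ => ?_
  rw [conjTranspose_tensorOp, tensorOp_mul, tensorOp_mul]
  congr 1
  funext v
  congr 2
  rcases v with _ | ⟨i, j⟩
  · rfl
  · by_cases hj : j = e i
    · subst hj; simp [edgeFactor, LadderEdge.player]
    · simp [edgeFactor, hj]

/-- If the observables of the players are mixtures of conjugates by local Kraus operators, then the
expectation is the sum of the expectations in the branches, one for each choice of a Kraus operator
at every vertex. The completeness relation takes care of the vertices outside the hyperedge. -/
theorem edgeExpectation_kraus {β : Type} [Fintype β] (K : LadderVertex n → β → QubitOp)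
    (hK : ∀ v, ∑ b, (K v b).conjTranspose * K v b = 1) (ρ : NetworkOp (LadderVertex n))
    (e : LadderEdge n) (B : Role n → QubitOp) (B' : Role n → β → QubitOp)
    (hB : ∀ r, B r =
      ∑ b, (K (e.player r) b).conjTranspose * B' r b * K (e.player r) b) :
    edgeExpectation ρ e B = ∑ b : LadderVertex n → β,
      edgeExpectation (tensorOp (fun v => K v (b v)) * ρ *
        (tensorOp fun v => K v (b v)).conjTranspose) e fun r => B' r (b (e.player r)) := by
  rw [edgeExpectation, edgeFactor_kraus K hK e B B' hB, Finset.mul_sum, Matrix.trace_sum,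
    Complex.re_sum]
  refine Finset.sum_congr rfl fun b _ => ?_
  rw [edgeExpectation]
  generalize tensorOp (fun v => K v (b v)) = L
  generalize tensorOp (edgeFactor e _) = M
  rw [Matrix.mul_assoc L, Matrix.mul_assoc L, Matrix.trace_mul_comm L]
  simp only [Matrix.mul_assoc]

theorem trace_kraus {V β : Type} [Fintype V] [DecidableEq V] [Fintype β]
    (K : V → β → QubitOp)
    (hK : ∀ v, ∑ b, (K v b).conjTranspose * K v b = 1) (ρ : NetworkOp V) :
    ∑ b : V → β, (tensorOp (fun v => K v (b v)) * ρ *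
        (tensorOp fun v => K v (b v)).conjTranspose).trace = ρ.trace := by
  have h : ∑ b : V → β, (tensorOp fun v => K v (b v)).conjTranspose *
      tensorOp (fun v => K v (b v)) = 1 := by
    simp only [conjTranspose_tensorOp, tensorOp_mul]
    rw [← tensorOp_sum (fun v b => (K v b).conjTranspose * K v b)]
    simp only [hK, tensorOp_one]
  calc _ = ∑ b : V → β, (((tensorOp fun v => K v (b v)).conjTranspose *
      tensorOp (fun v => K v (b v))) * ρ).trace := by
        refine Finset.sum_congr rfl fun b _ => ?_
        rw [Matrix.trace_mul_comm, Matrix.mul_assoc]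
    _ = _ := by rw [← Matrix.trace_sum, ← Finset.sum_mul, h, one_mul]

/-- The expectation is the full trace, which is real, for Hermitian state and observables. -/
theorem sq_edgeExpectation {ρ : NetworkOp (LadderVertex n)} (hρ : ρ.IsHermitian)
    (e : LadderEdge n) {B : Role n → QubitOp} (hB : ∀ r, (B r).IsHermitian) :
    edgeExpectation ρ e B ^ 2 = ‖(ρ * tensorOp (edgeFactor e B)).trace‖ ^ 2 := by
  have hM : (tensorOp (edgeFactor e B)).conjTranspose = tensorOp (edgeFactor e B) := by
    rw [conjTranspose_tensorOp]
    congr 1; funext v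
    rcases v with _ | ⟨i, j⟩
    · exact hB none
    · by_cases hj : j = e i
      · simpa [edgeFactor, hj] using (hB (some i)).eq
      · simp [edgeFactor, hj]
  have : star (ρ * tensorOp (edgeFactor e B)).trace = (ρ * tensorOp (edgeFactor e B)).trace := by
    rw [← Matrix.trace_conjTranspose, Matrix.conjTranspose_mul, hM, hρ.eq, Matrix.trace_mul_comm]
  obtain ⟨r, hr⟩ := Complex.conj_eq_iff_real.1 this
  rw [edgeExpectation, hr]; simp

end Edge

/-! ### Spin observables -/

theorem spinObservable_apply (u : EuclideanSpace ℝ (Fin 3)) :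
    spinObservable u = !![(u 2 : ℂ), u 0 - u 1 * Complex.I; u 0 + u 1 * Complex.I, -u 2] := by
  ext i j
  fin_cases i <;> fin_cases j <;> (simp [spinObservable]; try ring)

theorem isHermitian_spinObservable (u : EuclideanSpace ℝ (Fin 3)) :
    (spinObservable u).IsHermitian := by
  rw [spinObservable_apply]
  ext i j
  fin_cases i <;> fin_cases j <;> simp [Matrix.conjTranspose_apply, sub_eq_add_neg]

theorem spinObservable_add (u v : EuclideanSpace ℝ (Fin 3)) :
    spinObservable (u + v) = spinObservable u + spinObservable v := by
  simp only [spinObservable_apply]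
  ext i j
  fin_cases i <;> fin_cases j <;> simp <;> ring

theorem spinObservable_smul (t : ℝ) (u : EuclideanSpace ℝ (Fin 3)) :
    spinObservable (t • u) = (t : ℂ) • spinObservable u := by
  simp only [spinObservable_apply]
  ext i j
  fin_cases i <;> fin_cases j <;> simp <;> ring

theorem spinObservable_mul_add_mul (u v : EuclideanSpace ℝ (Fin 3)) :
    spinObservable u * spinObservable v + spinObservable v * spinObservable u =
      ((2 * inner ℝ u v : ℝ) : ℂ) • (1 : QubitOp) := by
  simp only [spinObservable_apply, PiLp.inner_apply, Fin.sum_univ_three]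
  ext i j
  fin_cases i <;> fin_cases j <;> simp <;>
    first | ring1 | linear_combination (-2 * u 1 * v 1 : ℂ) * Complex.I_sq

theorem spinObservable_mul_self {u : EuclideanSpace ℝ (Fin 3)} (hu : ‖u‖ = 1) :
    spinObservable u * spinObservable u = 1 := by
  have h := spinObservable_mul_add_mul u u
  rw [real_inner_self_eq_norm_sq, hu, ← two_smul ℂ] at h
  have h2 := congrArg (fun M : QubitOp => (2⁻¹ : ℂ) • M) h
  simpa [smul_smul] using h2

theorem IsBinaryObservable.eq_one_or_spin {A : QubitOp} (hA : IsBinaryObservable A) :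
    A = 1 ∨ A = -1 ∨ ∃ u, ‖u‖ = 1 ∧ A = spinObservable u := by
  obtain ⟨hH, hsq⟩ := hA
  have h00 := hH.apply 0 0
  have h11 := hH.apply 1 1
  have h10 := hH.apply 0 1
  obtain ⟨a, ha⟩ := Complex.conj_eq_iff_real.1 h00
  obtain ⟨d, hd⟩ := Complex.conj_eq_iff_real.1 h11
  have q00 := congrFun (congrFun hsq 0) 0
  have q01 := congrFun (congrFun hsq 0) 1
  have q11 := congrFun (congrFun hsq 1) 1
  obtain ⟨x, y, hb⟩ : ∃ x y : ℝ, A 0 1 = x + y * Complex.I :=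
    ⟨(A 0 1).re, (A 0 1).im, (Complex.re_add_im _).symm⟩
  have hc : A 1 0 = x - y * Complex.I := by
    have := congrArg star h10
    simp only [star_star] at this
    rw [this, hb]; simp [sub_eq_add_neg]
  simp only [Matrix.mul_apply, Fin.sum_univ_two, ha, hd, hb, hc, Matrix.one_apply_eq,
    Matrix.one_apply_ne (zero_ne_one (α := Fin 2))] at q00 q01 q11
  have r00 : a * a + x * x + y * y = 1 := by
    have := congrArg Complex.re q00
    simp at this; linarith
  have r11 : d * d + x * x + y * y = 1 := by
    have := congrArg Complex.re q11
    simp at this; linarith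
  have rx : x * (a + d) = 0 := by
    have := congrArg Complex.re q01
    simp at this; linarith
  have ry : y * (a + d) = 0 := by
    have := congrArg Complex.im q01
    simp at this; linarith
  by_cases had : a + d = 0
  · right; right
    refine ⟨!₂[x, -y, a], ?_, ?_⟩
    · rw [EuclideanSpace.norm_eq, Real.sqrt_eq_one]
      simp [Fin.sum_univ_three]; linarith
    · have : d = -a := by linarith
      rw [spinObservable_apply]
      ext i j
      fin_cases i <;> fin_cases j <;> (simp [ha, hb, hc, hd, this]; try ring)
  · have hx : x = 0 := by simpa [had] using rx
    have hy : y = 0 := by simpa [had] using ry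
    subst hx hy
    have hdd : d = a := by
      have : (a + d) * (a - d) = 0 := by nlinarith
      rcases mul_eq_zero.1 this with h | h
      · exact absurd h had
      · linarith
    have : a = 1 ∨ a = -1 := mul_self_eq_one_iff.1 (by linarith)
    rcases this with h | h
    · left
      ext i j
      fin_cases i <;> fin_cases j <;> simp [ha, hb, hc, hd, hdd, h]
    · right; left
      ext i j
      fin_cases i <;> fin_cases j <;> simp [ha, hb, hc, hd, hdd, h]

/-- The Pauli matrices `σ_x` (index `0`) and `σ_y` (index `1`). -/
noncomputable def pauli (k : Fin 2) : QubitOp :=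
  if k = 0 then !![0, 1; 1, 0] else !![0, -Complex.I; Complex.I, 0]

theorem isHermitian_pauli (k : Fin 2) : (pauli k).IsHermitian := by
  ext i j
  fin_cases k <;> fin_cases i <;> fin_cases j <;> simp [pauli, Matrix.conjTranspose_apply]

/-- Any two anticommuting Hermitian involutions of a qubit are `σ_x`, `σ_y` in a suitable
orthonormal basis. -/
theorem exists_unitary_pauli {A B : QubitOp} (hA : A.IsHermitian) (hB : B.IsHermitian)
    (hAA : A * A = 1) (hBB : B * B = 1) (hAB : A * B = -(B * A)) :
    ∃ U : QubitOp, U.conjTranspose * U = 1 ∧ U * pauli 0 * U.conjTranspose = A ∧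
      U * pauli 1 * U.conjTranspose = B := by
  -- `C` is to become `σ_z`, so the columns of `U` are a `+1` eigenvector `f` of `C` and `A f`.
  set C : QubitOp := -Complex.I • (A * B) with hC
  have hAABB : A * B * (A * B) = -1 := by
    calc A * B * (A * B) = A * B * -(B * A) := by rw [hAB]
      _ = -(A * (B * B) * A) := by noncomm_ring
      _ = -1 := by rw [hBB, mul_one, hAA]
  have hCC : C * C = 1 := by
    rw [hC, Matrix.smul_mul, Matrix.mul_smul, smul_smul, hAABB]
    simp
  have hCne : (1 + C) ≠ 0 := by
    intro h
    have h1 : A * C = -A := by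
      rw [← sub_eq_zero]
      calc A * C - -A = A * (1 + C) := by noncomm_ring
        _ = 0 := by rw [h, mul_zero]
    have h2 : C * A = -A := by
      rw [← sub_eq_zero]
      calc C * A - -A = (1 + C) * A := by noncomm_ring
        _ = 0 := by rw [h, zero_mul]
    have h3 : A * C = -(C * A) := by
      rw [hC, Matrix.mul_smul, Matrix.smul_mul, ← smul_neg]
      congr 1
      rw [hAB]; noncomm_ring
      rw [← mul_assoc, hAB]; noncomm_ring
    rw [h1, h2, neg_neg] at h3
    have h4 : A = 0 := by
      have : (2 : ℂ) • A = 0 := by rw [two_smul]; nth_rewrite 1 [← h3]; simp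
      simpa using this
    rw [h4, zero_mul] at hAA
    exact zero_ne_one hAA
  obtain ⟨f, hf1, hCf⟩ : ∃ f : Fin 2 → ℂ, star f ⬝ᵥ f = 1 ∧ C.mulVec f = f := by
    obtain ⟨x, hx⟩ : ∃ x, (1 + C).mulVec x ≠ 0 := by
      by_contra! h
      exact hCne (Matrix.ext_iff_mulVec.2 fun x => by rw [h x, Matrix.zero_mulVec])
    set y := (1 + C).mulVec x with hy
    have hCy : C.mulVec y = y := by
      rw [hy, Matrix.mulVec_mulVec, mul_add, hCC, mul_one, add_comm]
    have hpos : 0 < star y ⬝ᵥ y := by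
      rw [Matrix.dotProduct_star_self_pos_iff]; exact hx
    obtain ⟨t, ht⟩ : ∃ t : ℝ, star y ⬝ᵥ y = t := ⟨_, (Complex.eq_re_of_ofReal_le hpos.le)⟩
    have ht0 : 0 < t := by rw [ht] at hpos; exact_mod_cast hpos
    refine ⟨((√t)⁻¹ : ℂ) • y, ?_, ?_⟩
    · rw [star_smul, smul_dotProduct, dotProduct_smul, ht]
      have : (√t : ℂ) * √t = t := by exact_mod_cast Real.mul_self_sqrt ht0.le
      have h0 : (t : ℂ) ≠ 0 := by exact_mod_cast ht0.ne'
      simp only [smul_eq_mul, star_inv₀, Complex.star_def, Complex.conj_ofReal]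
      rw [← mul_assoc, ← mul_inv, this, inv_mul_cancel₀ h0]
    · rw [Matrix.mulVec_smul, hCy]
  have hCH : C.IsHermitian := by
    rw [Matrix.IsHermitian, hC, Matrix.conjTranspose_smul, Matrix.conjTranspose_mul, hA.eq, hB.eq,
      hAB]
    simp
  have hCA : C * A = -(A * C) := by
    rw [hC, Matrix.mul_smul, Matrix.smul_mul, ← smul_neg, mul_assoc A B A]
    congr 1
    rw [← mul_neg, hAB, neg_neg]
  have hBf : B.mulVec f = Complex.I • A.mulVec f := by
    have h : Complex.I • A * C = B := by
      rw [hC, Matrix.smul_mul, Matrix.mul_smul, smul_smul, ← mul_assoc, hAA, one_mul]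
      simp
    rw [← Matrix.smul_mulVec, ← h, ← Matrix.mulVec_mulVec, hCf]
  have hffA : star f ⬝ᵥ A.mulVec f = 0 := by
    have h1 : star f ⬝ᵥ (C * A).mulVec f = star f ⬝ᵥ A.mulVec f := by
      rw [← Matrix.mulVec_mulVec, Matrix.dotProduct_mulVec, ← hCH.eq, ← Matrix.star_mulVec, hCf]
    have h2 : star f ⬝ᵥ (C * A).mulVec f = -(star f ⬝ᵥ A.mulVec f) := by
      rw [hCA, Matrix.neg_mulVec, dotProduct_neg, ← Matrix.mulVec_mulVec, hCf]
    exact self_eq_neg.1 (h1.symm.trans h2)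
  have hAAf : A.mulVec (A.mulVec f) = f := by
    rw [Matrix.mulVec_mulVec, hAA, Matrix.one_mulVec]
  have hBAf : B.mulVec (A.mulVec f) = -Complex.I • f := by
    have : B * A = -(A * B) := by rw [hAB, neg_neg]
    rw [Matrix.mulVec_mulVec, this, Matrix.neg_mulVec, ← Matrix.mulVec_mulVec, hBf,
      Matrix.mulVec_smul, hAAf, neg_smul]
  set g := A.mulVec f with hg
  have hgf : star g ⬝ᵥ f = 0 := by
    rw [hg, Matrix.star_mulVec, hA.eq, ← Matrix.dotProduct_mulVec, ← hg, hffA]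
  have hgg : star g ⬝ᵥ g = 1 := by
    conv_lhs => rw [hg, Matrix.star_mulVec, hA.eq, ← Matrix.dotProduct_mulVec, ← hg, hAAf]
    exact hf1
  set U : QubitOp := (Matrix.of ![f, g]).transpose with hU
  have hUU : U.conjTranspose * U = 1 := by
    ext i j
    simp only [dotProduct, Fin.sum_univ_two, Pi.star_apply] at hf1 hffA hgf hgg
    fin_cases i <;> fin_cases j <;>
      simpa [hU, Matrix.mul_apply, Matrix.conjTranspose_apply, Fin.sum_univ_two]
  have hUU' : U * U.conjTranspose = 1 := mul_eq_one_comm.1 hUU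
  refine ⟨U, hUU, ?_, ?_⟩
  · have : U * pauli 0 = A * U := by
      ext i j
      have h1 := congrFun hg i
      have h2 := congrFun hAAf i
      simp only [Matrix.mulVec, dotProduct, Fin.sum_univ_two] at h1 h2
      fin_cases j <;> simp [pauli, hU, Matrix.mul_apply, Fin.sum_univ_two, h1, h2]
    rw [this, mul_assoc, hUU', mul_one]
  · have : U * pauli 1 = B * U := by
      ext i j
      have h1 := congrFun hBf i
      have h2 := congrFun hBAf i
      simp only [Matrix.mulVec, dotProduct, Fin.sum_univ_two, Pi.smul_apply, smul_eq_mul] at h1 h2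
      fin_cases j <;> simp [pauli, hU, Matrix.mul_apply, Fin.sum_univ_two, h1, h2, mul_comm]
    rw [this, mul_assoc, hUU', mul_one]

/-! ### Binary observables as planar observables -/

theorem exists_unit_inner_eq_zero (v : EuclideanSpace ℝ (Fin 3)) :
    ∃ w : EuclideanSpace ℝ (Fin 3), ‖w‖ = 1 ∧ inner ℝ v w = 0 := by
  have h : (ℝ ∙ v)ᗮ ≠ ⊥ := by
    intro h
    have h1 := (ℝ ∙ v).finrank_add_finrank_orthogonal
    have h2 : Module.finrank ℝ (ℝ ∙ v) ≤ 1 := by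
      simpa using finrank_span_le_card (R := ℝ) {v}
    rw [h, finrank_bot, finrank_euclideanSpace_fin] at h1
    omega
  obtain ⟨w, hw, hw0⟩ := Submodule.exists_mem_ne_zero_of_ne_bot h
  refine ⟨‖w‖⁻¹ • w, norm_smul_inv_norm (𝕜 := ℝ) hw0, ?_⟩
  rw [inner_smul_right, Submodule.mem_orthogonal_singleton_iff_inner_right.1 hw, mul_zero]

theorem orthonormal_pair {E : Type*} [NormedAddCommGroup E] [InnerProductSpace ℝ E] {u v : E}
    (hu : ‖u‖ = 1) (hv : ‖v‖ = 1) (h : inner ℝ u v = 0) : Orthonormal ℝ ![u, v] := by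
  constructor
  · intro i; fin_cases i <;> simpa
  · intro i j hij
    fin_cases i <;> fin_cases j <;> simp_all [real_inner_comm]

/-- Two orthogonal vectors that are not both zero lie on the axes of an orthonormal pair. -/
theorem exists_orthonormal_of_inner_eq_zero {m d : EuclideanSpace ℝ (Fin 3)}
    (h : inner ℝ m d = 0) (hne : m ≠ 0 ∨ d ≠ 0) :
    ∃ o : Fin 2 → EuclideanSpace ℝ (Fin 3), Orthonormal ℝ o ∧
      m = ‖m‖ • o 0 ∧ d = ‖d‖ • o 1 := by
  have key : ∀ v : EuclideanSpace ℝ (Fin 3), v ≠ 0 →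
      ‖‖v‖⁻¹ • v‖ = 1 ∧ v = ‖v‖ • ‖v‖⁻¹ • v := fun v hv =>
    ⟨norm_smul_inv_norm (𝕜 := ℝ) hv, by
      rw [smul_smul, mul_inv_cancel₀ (norm_ne_zero_iff.2 hv), one_smul]⟩
  by_cases hm : m = 0
  · subst hm
    have hd := key d (hne.resolve_left (by simp))
    obtain ⟨w, hw, hdw⟩ := exists_unit_inner_eq_zero d
    refine ⟨![w, ‖d‖⁻¹ • d], orthonormal_pair hw hd.1 ?_, by simp, by simpa using hd.2⟩
    rw [inner_smul_right, real_inner_comm, hdw, mul_zero]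
  by_cases hd : d = 0
  · subst hd
    have hm := key m hm
    obtain ⟨w, hw, hmw⟩ := exists_unit_inner_eq_zero m
    refine ⟨![‖m‖⁻¹ • m, w], orthonormal_pair hm.1 hw ?_, by simpa using hm.2, by simp⟩
    rw [real_inner_smul_left, hmw, mul_zero]
  · have hm := key m hm
    have hd := key d hd
    refine ⟨![‖m‖⁻¹ • m, ‖d‖⁻¹ • d], orthonormal_pair hm.1 hd.1 ?_, by simpa using hm.2,
      by simpa using hd.2⟩
    rw [real_inner_smul_left, inner_smul_right, h, mul_zero, mul_zero]

theorem exists_unitary_spinObservable {o : Fin 2 → EuclideanSpace ℝ (Fin 3)}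
    (ho : Orthonormal ℝ o) :
    ∃ U : QubitOp, U.conjTranspose * U = 1 ∧ U * U.conjTranspose = 1 ∧
      ∀ k, spinObservable (o k) = U * pauli k * U.conjTranspose := by
  obtain ⟨U, hU, h0, h1⟩ := exists_unitary_pauli (isHermitian_spinObservable (o 0))
    (isHermitian_spinObservable (o 1)) (spinObservable_mul_self (ho.1 0))
    (spinObservable_mul_self (ho.1 1)) (by
      have := spinObservable_mul_add_mul (o 0) (o 1)
      rw [ho.2 zero_ne_one] at this
      exact eq_neg_of_add_eq_zero_left (by simpa using this))
  refine ⟨U, hU, mul_eq_one_comm.1 hU, fun k => ?_⟩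
  fin_cases k
  · exact h0.symm
  · exact h1.symm

/-- The character `(-1) ^ (x * k)` of `ℤ/2`. -/
def walsh (x k : Fin 2) : ℤˣ := if x = 1 ∧ k = 1 then -1 else 1

/-- The observable `q 0 • σ_x + (-1) ^ x * q 1 • σ_y` at the setting `x`. -/
noncomputable def planarObservable (q : Fin 2 → ℝ) (x : Fin 2) : QubitOp :=
  ∑ k, (((walsh x k : ℤ) * q k : ℝ) : ℂ) • pauli k

/-- One branch of a pair of commuting observables: on the eigenprojection `P` of `u · σ` both
outcomes are fixed signs `f 0`, `f 1`. Either of `σ_x`, `σ_y` can be rotated onto `u · σ`, and the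
choice decides whether the two signs agree. -/
theorem exists_planar_of_projection {u : EuclideanSpace ℝ (Fin 3)} (hu : ‖u‖ = 1) {P : QubitOp}
    (hP : P.IsHermitian) (hPP : P * P = P) {τ : ℝ} (hτ : τ ^ 2 = 1)
    (hPu : P * spinObservable u * P = (τ : ℂ) • P) {f : Fin 2 → ℝ} (hf : ∀ x, f x ^ 2 = 1) :
    ∃ (K : QubitOp) (q : Fin 2 → ℝ), ∑ k, q k ^ 2 = 1 ∧ K.conjTranspose * K = P ∧
      ∀ x, (f x : ℂ) • P = K.conjTranspose * planarObservable q x * K := by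
  obtain ⟨k, hk⟩ : ∃ k, ∀ x, f x = (walsh x k : ℤ) * f 0 := by
    have h : f 1 = f 0 ∨ f 1 = -f 0 := sq_eq_sq_iff_eq_or_eq_neg.1 (by rw [hf, hf])
    rcases h with h | h
    · exact ⟨0, fun x => by fin_cases x <;> simp [walsh, h]⟩
    · exact ⟨1, fun x => by fin_cases x <;> simp [walsh, h]⟩
  obtain ⟨w, hw, huw⟩ := exists_unit_inner_eq_zero u
  obtain ⟨U, -, hUU, hU⟩ : ∃ U : QubitOp, U.conjTranspose * U = 1 ∧ U * U.conjTranspose = 1 ∧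
      spinObservable u = U * pauli k * U.conjTranspose := by
    fin_cases k
    · obtain ⟨U, h1, h2, h3⟩ := exists_unitary_spinObservable (orthonormal_pair hu hw huw)
      exact ⟨U, h1, h2, h3 0⟩
    · obtain ⟨U, h1, h2, h3⟩ := exists_unitary_spinObservable
        (orthonormal_pair hw hu (by rwa [real_inner_comm]))
      exact ⟨U, h1, h2, h3 1⟩
  refine ⟨U.conjTranspose * P, Pi.single k (τ * f 0), ?_, ?_, fun x => ?_⟩
  · rw [Finset.sum_eq_single k] <;> simp +contextual [mul_pow, hτ, hf]
  · rw [Matrix.conjTranspose_mul, Matrix.conjTranspose_conjTranspose, hP.eq]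
    calc P * U * (U.conjTranspose * P) = P * (U * U.conjTranspose) * P := by
          simp only [mul_assoc]
      _ = P := by rw [hUU, mul_one, hPP]
  · have h : planarObservable (Pi.single k (τ * f 0)) x = ((τ * f x : ℝ) : ℂ) • pauli k := by
      rw [planarObservable, Finset.sum_eq_single k]
      · rw [Pi.single_eq_same, hk x]; congr 2; ring
      · intro b _ hb; simp [hb]
      · simp
    rw [h, Matrix.conjTranspose_mul, Matrix.conjTranspose_conjTranspose, hP.eq, Matrix.mul_smul,
      Matrix.smul_mul]
    have h2 : P * U * pauli k * (U.conjTranspose * P) = P * spinObservable u * P := by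
      rw [hU]; simp only [mul_assoc]
    rw [h2, hPu, smul_smul]
    congr 1
    norm_cast
    linear_combination (-f x) * hτ

/-- A pair of binary observables on a qubit is, up to a Kraus decomposition into two branches, a
pair of unit vectors in the `σ_x σ_y`-plane placed symmetrically about the axes. Two spin
observables need only one branch, a rotation of their plane. If one of the observables is `1` or
`-1`, it has no such plane; the two observables then commute, and each branch is a projection onto
a common eigenvector. -/
theorem exists_kraus_planar {A : Fin 2 → QubitOp} (hA : ∀ x, IsBinaryObservable (A x)) :
    ∃ (K : Fin 2 → QubitOp) (q : Fin 2 → Fin 2 → ℝ), (∀ b, ∑ k, q b k ^ 2 = 1) ∧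
      ∑ b, (K b).conjTranspose * K b = 1 ∧
      ∀ x, A x = ∑ b, (K b).conjTranspose * planarObservable (q b) x * K b := by
  have commuting : ∀ u : EuclideanSpace ℝ (Fin 3), ‖u‖ = 1 →
      (∀ x, A x = 1 ∨ A x = -1 ∨ A x = spinObservable u) →
      ∃ (K : Fin 2 → QubitOp) (q : Fin 2 → Fin 2 → ℝ), (∀ b, ∑ k, q b k ^ 2 = 1) ∧
      ∑ b, (K b).conjTranspose * K b = 1 ∧
      ∀ x, A x = ∑ b, (K b).conjTranspose * planarObservable (q b) x * K b := by
    intro u hu hAu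
    set τ : Fin 2 → ℝ := ![1, -1] with hτ
    set P : Fin 2 → QubitOp := fun b => (2⁻¹ : ℂ) • (1 + (τ b : ℂ) • spinObservable u) with hP
    have hτ2 : ∀ b, τ b ^ 2 = 1 := by intro b; fin_cases b <;> simp [hτ]
    have hsu := spinObservable_mul_self hu
    have hPu : ∀ b, P b * spinObservable u = (τ b : ℂ) • P b := by
      intro b
      have : (τ b : ℂ) * τ b = 1 := by rw [← sq]; exact_mod_cast hτ2 b
      simp only [hP, Matrix.smul_mul, add_mul, one_mul, hsu, smul_add, smul_smul]
      rw [add_comm, mul_left_comm, this, mul_one, mul_comm]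
    have hPP : ∀ b, P b * P b = P b := by
      intro b
      have : (τ b : ℂ) * τ b = 1 := by rw [← sq]; exact_mod_cast hτ2 b
      nth_rewrite 2 [hP]
      simp only
      rw [Matrix.mul_smul, mul_add, mul_one, Matrix.mul_smul, hPu, smul_smul, this, one_smul,
        ← two_smul ℂ, smul_smul]
      simp
    have hPH : ∀ b, (P b).IsHermitian := by
      intro b
      simp [hP, Matrix.IsHermitian, Matrix.conjTranspose_smul,
        (isHermitian_spinObservable u).eq]
    have hf : ∀ x, ∃ f : Fin 2 → ℝ, (∀ b, f b ^ 2 = 1) ∧ A x = ∑ b, (f b : ℂ) • P b := by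
      intro x
      rcases hAu x with h | h | h
      · refine ⟨fun _ => 1, by simp, ?_⟩
        rw [h]; simp [hP, hτ, Fin.sum_univ_two]; module
      · refine ⟨fun _ => -1, by simp, ?_⟩
        rw [h]; simp [hP, hτ, Fin.sum_univ_two]; module
      · refine ⟨τ, hτ2, ?_⟩
        rw [h]; simp [hP, hτ, Fin.sum_univ_two]; module
    choose f hf1 hfA using hf
    have hK : ∀ b, ∃ (K : QubitOp) (q : Fin 2 → ℝ), ∑ k, q k ^ 2 = 1 ∧
        K.conjTranspose * K = P b ∧
        ∀ x, (f x b : ℂ) • P b = K.conjTranspose * planarObservable q x * K := fun b =>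
      exists_planar_of_projection hu (hPH b) (hPP b) (hτ2 b)
        (by rw [hPu, Matrix.smul_mul, hPP]) fun x => hf1 x b
    choose K q hq hKP hKA using hK
    refine ⟨K, q, hq, ?_, fun x => ?_⟩
    · simp only [hKP]
      simp [hP, hτ, Fin.sum_univ_two]; module
    · rw [hfA x]; exact Finset.sum_congr rfl fun b _ => hKA b x
  obtain ⟨v, hv, -⟩ := exists_unit_inner_eq_zero 0
  rcases (hA 0).eq_one_or_spin with h0 | h0 | ⟨u0, hu0, h0⟩ <;>
    rcases (hA 1).eq_one_or_spin with h1 | h1 | ⟨u1, hu1, h1⟩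
  · exact commuting v hv (by simp [Fin.forall_fin_two, h0, h1])
  · exact commuting v hv (by simp [Fin.forall_fin_two, h0, h1])
  · exact commuting u1 hu1 (by simp [Fin.forall_fin_two, h0, h1])
  · exact commuting v hv (by simp [Fin.forall_fin_two, h0, h1])
  · exact commuting v hv (by simp [Fin.forall_fin_two, h0, h1])
  · exact commuting u1 hu1 (by simp [Fin.forall_fin_two, h0, h1])
  · exact commuting u0 hu0 (by simp [Fin.forall_fin_two, h0, h1])
  · exact commuting u0 hu0 (by simp [Fin.forall_fin_two, h0, h1])
  · -- The sum and the difference of two unit vectors are orthogonal.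
    have horth : inner ℝ (u0 + u1) (u0 - u1) = 0 := by
      rw [real_inner_add_sub_eq_zero_iff, hu0, hu1]
    have hne : u0 + u1 ≠ 0 ∨ u0 - u1 ≠ 0 := by
      by_contra! h
      have h2 : (2 : ℝ) • u0 = 0 := by
        rw [two_smul]
        calc u0 + u0 = (u0 + u1) + (u0 - u1) := by abel
          _ = 0 := by rw [h.1, h.2, add_zero]
      have h3 : u0 = 0 := by simpa using h2
      rw [h3, norm_zero] at hu0
      exact zero_ne_one hu0
    obtain ⟨o, ho, hm, hd⟩ := exists_orthonormal_of_inner_eq_zero horth hne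
    obtain ⟨U, hU1, hU2, hU⟩ := exists_unitary_spinObservable ho
    set C := ‖u0 + u1‖ / 2 with hC
    set S := ‖u0 - u1‖ / 2 with hS
    have hC2 : ‖u0 + u1‖ = 2 * C := by rw [hC]; ring
    have hS2 : ‖u0 - u1‖ = 2 * S := by rw [hS]; ring
    have hu : ∀ x, A x = ((C : ℂ)) • spinObservable (o 0) +
        (((walsh x 1 : ℤ) * S : ℝ) : ℂ) • spinObservable (o 1) := by
      have hx0 : u0 = C • o 0 + S • o 1 := by
        calc u0 = (2⁻¹ : ℝ) • ((u0 + u1) + (u0 - u1)) := by module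
          _ = _ := by rw [hm, hd, hC2, hS2]; module
      have hx1 : u1 = C • o 0 + (-S) • o 1 := by
        calc u1 = (2⁻¹ : ℝ) • ((u0 + u1) - (u0 - u1)) := by module
          _ = _ := by rw [hm, hd, hC2, hS2]; module
      intro x
      fin_cases x
      · rw [← spinObservable_smul, ← spinObservable_smul, ← spinObservable_add]
        simpa [walsh, h0] using congrArg spinObservable hx0
      · rw [← spinObservable_smul, ← spinObservable_smul, ← spinObservable_add]
        simpa [walsh, h1] using congrArg spinObservable hx1
    refine ⟨![U.conjTranspose, 0], fun _ => ![C, S], fun _ => ?_, ?_, fun x => ?_⟩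
    · have := parallelogram_law_with_norm ℝ u0 u1
      rw [hu0, hu1] at this
      simp [Fin.sum_univ_two, hC, hS]; linarith
    · simpa [Fin.sum_univ_two] using hU2
    · rw [hu x, hU, hU]
      simp [Fin.sum_univ_two, planarObservable, walsh, mul_add, add_mul]

/-! ### Correlation tensors and coherences -/

/-- Minkowski's inequality in `ℓ²`. -/
theorem sqrt_sum_sq_sum_le {ι κ : Type*} [Fintype κ] (s : Finset ι) (f : ι → κ → ℝ) :
    √(∑ k, (∑ i ∈ s, f i k) ^ 2) ≤ ∑ i ∈ s, √(∑ k, f i k ^ 2) := by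
  have h := norm_sum_le s fun i => WithLp.toLp 2 (f i)
  simpa only [EuclideanSpace.norm_eq, Real.norm_eq_abs, sq_abs, WithLp.ofLp_sum,
    Finset.sum_apply] using h

/-- Parseval's identity for the change from the `σ_x, σ_y` basis to the basis of the matrix
units. -/
theorem sum_sq_norm_pauli_transform {R : Type} [Fintype R] [DecidableEq R]
    (G : (R → Fin 2) → ℂ) :
    ∑ k : R → Fin 2, ‖∑ s, G s * ∏ r, pauli (k r) (s r + 1) (s r)‖ ^ 2 =
      2 ^ Fintype.card R * ∑ s, ‖G s‖ ^ 2 := by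
  have orth : ∀ s s' : Fin 2, ∑ k, pauli k (s + 1) s * star (pauli k (s' + 1) s') =
      if s = s' then 2 else 0 := by
    intro s s'
    fin_cases s <;> fin_cases s' <;> simp [pauli, Fin.sum_univ_two] <;> norm_num
  have h : ∀ s s' : R → Fin 2, ∑ k : R → Fin 2, (∏ r, pauli (k r) (s r + 1) (s r)) *
      star (∏ r, pauli (k r) (s' r + 1) (s' r)) =
      if s = s' then 2 ^ Fintype.card R else 0 := by
    intro s s'
    simp only [star_prod, ← Finset.prod_mul_distrib]
    rw [← Fintype.piFinset_univ, ← Finset.prod_univ_sum (fun _ => Finset.univ)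
      (fun r k => pauli k (s r + 1) (s r) * star (pauli k (s' r + 1) (s' r)))]
    simp only [orth, Finset.prod_ite_zero, Finset.mem_univ, true_imp_iff, funext_iff,
      Finset.prod_const, Finset.card_univ]
  have sq : ∀ z : ℂ, ((‖z‖ ^ 2 : ℝ) : ℂ) = z * star z := fun z => by
    rw [Complex.star_def, Complex.mul_conj, Complex.normSq_eq_norm_sq]
  apply Complex.ofReal_injective
  push_cast [Complex.ofReal_sum, Complex.ofReal_mul]
  simp only [← Complex.ofReal_pow, sq]
  calc _ = ∑ k : R → Fin 2, ∑ s, ∑ s', G s * star (G s') *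
        ((∏ r, pauli (k r) (s r + 1) (s r)) * star (∏ r, pauli (k r) (s' r + 1) (s' r))) := by
        refine Finset.sum_congr rfl fun k _ => ?_
        rw [star_sum, Finset.sum_mul_sum]
        refine Finset.sum_congr rfl fun s _ => Finset.sum_congr rfl fun s' _ => ?_
        rw [star_mul']; ring
    _ = ∑ s, ∑ s', G s * star (G s') * if s = s' then 2 ^ Fintype.card R else 0 := by
        rw [Finset.sum_comm]
        refine Finset.sum_congr rfl fun s _ => ?_
        rw [Finset.sum_comm]
        refine Finset.sum_congr rfl fun s' _ => ?_
        rw [← Finset.mul_sum, h]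
    _ = _ := by
        simp [Finset.mul_sum, mul_comm]

section Coherence

variable {n : ℕ}

/-- The computational basis state in which the players of `e` carry the bits `s`, and the two
qubits of the role `some i` have the parity `p i`. -/
def config (e : LadderEdge n) (s : Role n → Fin 2) (p : Fin (n - 1) → Fin 2) :
    LadderVertex n → Fin 2
  | none => s none
  | some (i, j) => s (some i) + p i * (j + e i)

theorem config_player (e : LadderEdge n) (s : Role n → Fin 2) (p : Fin (n - 1) → Fin 2)
    (r : Role n) : config e s p (e.player r) = s r := by
  rcases r with _ | i
  · rfl
  · simp only [config, LadderEdge.player]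
    generalize s (some i) = x, p i = y, e i = z
    decide +revert

theorem config_opposite (e : LadderEdge n) (s : Role n → Fin 2) (p : Fin (n - 1) → Fin 2)
    (i : Fin (n - 1)) : config e s p (some (i, e i + 1)) = s (some i) + p i := by
  simp only [config]
  generalize s (some i) = x, p i = y, e i = z
  decide +revert

/-- For a fixed hyperedge, the bits of its players and the parities are coordinates on the
computational basis. -/
def configEquiv (e : LadderEdge n) :
    (Role n → Fin 2) × (Fin (n - 1) → Fin 2) ≃ (LadderVertex n → Fin 2) where
  toFun q := config e q.1 q.2
  invFun a := (fun r => a (e.player r), fun i => a (some (i, e i)) + a (some (i, e i + 1)))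
  left_inv := by
    rintro ⟨s, p⟩
    refine Prod.ext (funext fun r => config_player e s p r) (funext fun i => ?_)
    simp only [config_opposite]
    rw [show config e s p (some (i, e i)) = s (some i) from config_player e s p (some i)]
    generalize s (some i) = x, p i = y
    decide +revert
  right_inv := by
    intro a
    funext v
    rcases v with _ | ⟨i, j⟩
    · rfl
    · simp only [config, LadderEdge.player]
      obtain h | h : j = e i ∨ j = e i + 1 := by omega
      · subst h
        generalize e i = z, a (some (i, e i)) = x, a (some (i, e i + 1)) = y
        decide +revert
      · subst h
        generalize e i = z, a (some (i, e i)) = x, a (some (i, e i + 1)) = y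
        decide +revert

/-- The sum of the matrix entries of `ρ` that connect the bits `s` of the players of `e` with the
opposite bits, the other qubits being unchanged; it is split by the parities `p`. -/
def coherence (ρ : NetworkOp (LadderVertex n)) (e : LadderEdge n) (s : Role n → Fin 2) : ℂ :=
  ∑ p, ρ (config e s p) (config e (s + 1) (p + 1))

/-- `σ_x` and `σ_y` flip a bit, so only the entries of `ρ` between states that differ exactly on the
players of `e` contribute. -/
theorem trace_mul_tensorOp_pauli (ρ : NetworkOp (LadderVertex n)) (e : LadderEdge n)
    (k : Role n → Fin 2) :
    (ρ * tensorOp (edgeFactor e fun r => pauli (k r))).trace =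
      ∑ s, coherence ρ e s * ∏ r, pauli (k r) (s r + 1) (s r) := by
  have hz : ∀ k s s' : Fin 2, s' ≠ s + 1 → pauli k s' s = 0 := by
    intro k s s' h
    fin_cases k <;> fin_cases s <;> fin_cases s' <;> simp_all [pauli]
  have hp : ∀ x y : Fin 2, x + 1 + (y + 1) = x + y := by decide
  have hp2 : ∀ x y z : Fin 2, x + 1 + z = x + y → z = y + 1 := by decide
  simp only [Matrix.trace, Matrix.diag, Matrix.mul_apply, coherence, Finset.sum_mul]
  rw [← (configEquiv e).sum_comp, Fintype.sum_prod_type]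
  refine Finset.sum_congr rfl fun s _ => Finset.sum_congr rfl fun p _ => ?_
  rw [← (configEquiv e).sum_comp, Finset.sum_eq_single (s + 1, p + 1)]
  · simp [configEquiv, tensorOp_edgeFactor_apply, config_player, config_opposite, hp]
  · rintro ⟨s', p'⟩ - hne
    simp only [configEquiv, Equiv.coe_fn_mk, tensorOp_edgeFactor_apply, config_player,
      config_opposite]
    by_cases hs : s' = s + 1
    · subst hs
      obtain ⟨i, hi⟩ : ∃ i, p' i ≠ p i + 1 := by
        by_contra! h
        exact hne (Prod.ext rfl (funext h))
      rw [Finset.prod_eq_zero (i := i) (Finset.mem_univ i), mul_zero, mul_zero]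
      exact if_neg fun h => hi (hp2 _ _ _ h)
    · obtain ⟨r, hr⟩ : ∃ r, s' r ≠ s r + 1 := by
        by_contra! h
        exact hs (funext h)
      rw [Finset.prod_eq_zero (i := r) (Finset.mem_univ r) (hz _ _ _ hr), zero_mul, mul_zero]
  · simp

theorem sum_sq_edgeExpectation_pauli (hn : 2 ≤ n) {ρ : NetworkOp (LadderVertex n)}
    (hρ : ρ.IsHermitian) (e : LadderEdge n) :
    ∑ k : Role n → Fin 2, edgeExpectation ρ e (fun r => pauli (k r)) ^ 2 =
      2 ^ n * ∑ s, ‖coherence ρ e s‖ ^ 2 := by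
  have h := sum_sq_norm_pauli_transform (coherence ρ e)
  rw [card_role n hn] at h
  simp only [sq_edgeExpectation hρ e fun r => isHermitian_pauli _, trace_mul_tensorOp_pauli, h]

theorem Matrix.PosSemidef.norm_apply_sq_le {ι : Type*} [Fintype ι] [DecidableEq ι]
    {M : Matrix ι ι ℂ} (hM : M.PosSemidef) (i j : ι) :
    ‖M i j‖ ^ 2 ≤ (M i i).re * (M j j).re := by
  have h := (hM.submatrix ![i, j]).det_nonneg
  rw [Matrix.det_fin_two] at h
  simp only [Matrix.submatrix_apply, Matrix.cons_val_zero, Matrix.cons_val_one] at h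
  have h2 := (Complex.le_def.1 h).1
  have h3 : M j i = star (M i j) := (hM.1.apply j i).symm
  have hi := (Complex.le_def.1 (hM.diag_nonneg (i := i))).2
  rw [h3, Complex.star_def, Complex.mul_conj, Complex.normSq_eq_norm_sq] at h2
  simp only [← hi, Complex.zero_re, Complex.zero_im, Complex.sub_re, Complex.mul_re, zero_mul,
    sub_zero, Complex.ofReal_re, sub_nonneg] at h2
  exact h2

end Coherence

/-! ### The trade-off for correlation tensors -/

section Bound

variable {n : ℕ}

theorem config_eq_config_zero (e : LadderEdge n) (t : Fin 2) (σ p : Fin (n - 1) → Fin 2) :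
    config e (fun r => r.elim t σ) p = config 0 (fun r => r.elim t (σ + p * e)) p := by
  funext v
  rcases v with _ | ⟨i, j⟩
  · rfl
  · simp only [config, Option.elim, Pi.add_apply, Pi.mul_apply, Pi.zero_apply, add_zero]
    generalize σ i = x, p i = y, e i = z
    decide +revert

theorem sum_role_config {M : Type*} [AddCommMonoid M] (f : (Role n → Fin 2) → M) :
    ∑ s, f s = ∑ t, ∑ σ : Fin (n - 1) → Fin 2, f fun r => r.elim t σ := by
  rw [← (Equiv.piOptionEquivProd (β := fun _ => Fin 2)).symm.sum_comp, Fintype.sum_prod_type]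
  refine Finset.sum_congr rfl fun t _ => Finset.sum_congr rfl fun σ _ => congrArg f ?_
  funext r
  cases r <;> rfl

/-- For a fixed bit `t` of Alice and fixed parities `p`, the hyperedges and the bits of their
players enumerate all pairs of a basis state with data `t`, `p` and one with the opposite data,
each pair once. -/
theorem sum_edge_pairs {M : Type*} [CommSemiring M] (f g : (LadderVertex n → Fin 2) → M)
    (t : Fin 2) (p : Fin (n - 1) → Fin 2) :
    ∑ q : LadderEdge n × (Fin (n - 1) → Fin 2),
      f (config q.1 (fun r => r.elim t q.2) p) *
        g (config q.1 ((fun r => r.elim t q.2) + 1) (p + 1)) =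
      (∑ α, f (config 0 (fun r => r.elim t α) p)) *
        ∑ β, g (config 0 (fun r => r.elim (t + 1) β) (p + 1)) := by
  have h1 : ∀ x p e : Fin 2, (x + p * e) + (x + 1 + (p + 1) * e) + 1 = e := by decide
  have h2 : ∀ α p β : Fin 2, α + p * (α + β + 1) + p * (α + β + 1) = α := by decide
  have h3 : ∀ α p β : Fin 2, α + p * (α + β + 1) + 1 + (p + 1) * (α + β + 1) = β := by decide
  have h4 : ∀ x p e : Fin 2,
      x + p * e + p * ((x + p * e) + (x + 1 + (p + 1) * e) + 1) = x := by decide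
  rw [Finset.sum_mul_sum, ← Fintype.sum_prod_type']
  refine Fintype.sum_equiv
    { toFun := fun q => (q.2 + p * q.1, q.2 + 1 + (p + 1) * q.1)
      invFun := fun q => (q.1 + q.2 + 1, q.1 + p * (q.1 + q.2 + 1))
      left_inv := fun q => Prod.ext (funext fun i => h1 _ _ _) (funext fun i => h4 _ _ _)
      right_inv := fun q => Prod.ext (funext fun i => h2 _ _ _) (funext fun i => h3 _ _ _) }
    _ _ fun q => ?_
  have h : ((fun r : Role n => r.elim t q.2) + 1) = fun r => r.elim (t + 1) (q.2 + 1) := by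
    funext r
    cases r <;> rfl
  rw [h, config_eq_config_zero, config_eq_config_zero q.1 (t + 1)]
  rfl

/-- The coherences with a fixed bit `t` of Alice, over all hyperedges, are bounded by the product of
the probabilities of the two values of that bit. -/
theorem sum_sq_coherence_le {ρ : NetworkOp (LadderVertex n)} (hρ : ρ.PosSemidef) (t : Fin 2) :
    ∑ q : LadderEdge n × (Fin (n - 1) → Fin 2),
      ‖coherence ρ q.1 fun r => r.elim t q.2‖ ^ 2 ≤
      (∑ p, ∑ α, (ρ (config 0 (fun r => r.elim t α) p)
        (config 0 (fun r => r.elim t α) p)).re) *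
      ∑ p, ∑ β, (ρ (config 0 (fun r => r.elim (t + 1) β) p)
        (config 0 (fun r => r.elim (t + 1) β) p)).re := by
  set w : (LadderVertex n → Fin 2) → ℝ := fun a => (ρ a a).re with hw
  have hw0 : ∀ a, 0 ≤ w a := fun a => (Complex.le_def.1 hρ.diag_nonneg).1
  set m : Fin 2 → (Fin (n - 1) → Fin 2) → ℝ :=
    fun t p => ∑ α, w (config 0 (fun r => r.elim t α) p) with hm
  have hm0 : ∀ t p, 0 ≤ m t p := fun t p => Finset.sum_nonneg fun _ _ => hw0 _
  set R : (Fin (n - 1) → Fin 2) → LadderEdge n × (Fin (n - 1) → Fin 2) → ℝ := fun p q =>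
    √(w (config q.1 (fun r => r.elim t q.2) p) *
      w (config q.1 ((fun r => r.elim t q.2) + 1) (p + 1))) with hR
  have hcoh : ∀ q : LadderEdge n × (Fin (n - 1) → Fin 2),
      ‖coherence ρ q.1 fun r => r.elim t q.2‖ ≤ ∑ p, R p q := fun q =>
    (norm_sum_le _ _).trans <| Finset.sum_le_sum fun p _ =>
      Real.le_sqrt_of_sq_le (hρ.norm_apply_sq_le _ _)
  have hRp : ∀ p, ∑ q, R p q ^ 2 = m t p * m (t + 1) (p + 1) := by
    intro p
    rw [hm, ← sum_edge_pairs]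
    exact Finset.sum_congr rfl fun q _ => Real.sq_sqrt (mul_nonneg (hw0 _) (hw0 _))
  have h1 : √(∑ q : LadderEdge n × (Fin (n - 1) → Fin 2),
      ‖coherence ρ q.1 fun r => r.elim t q.2‖ ^ 2) ≤ √(∑ p, m t p) * √(∑ p, m (t + 1) p) :=
    calc _ ≤ √(∑ q, (∑ p, R p q) ^ 2) := by
          gcongr with q
          exact hcoh q
      _ ≤ ∑ p, √(∑ q, R p q ^ 2) := sqrt_sum_sq_sum_le _ _
      _ = ∑ p, √(m t p) * √(m (t + 1) (p + 1)) := by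
          refine Finset.sum_congr rfl fun p _ => ?_
          rw [hRp, Real.sqrt_mul (hm0 _ _)]
      _ ≤ √(∑ p, m t p) * √(∑ p, m (t + 1) (p + 1)) :=
          Real.sum_sqrt_mul_sqrt_le _ (fun p => hm0 _ _) fun p => hm0 _ _
      _ = _ := by
          congr 2
          exact Equiv.sum_comp (Equiv.addRight (1 : Fin (n - 1) → Fin 2)) (m (t + 1))
  have hM : ∀ t, 0 ≤ ∑ p, m t p := fun t => Finset.sum_nonneg fun p _ => hm0 t p
  rw [← Real.sqrt_mul (hM t)] at h1
  exact (Real.sqrt_le_sqrt_iff (mul_nonneg (hM _) (hM _))).1 h1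

/-- The trade-off for the correlation tensors of all hyperedges in the `σ_x σ_y`-planes. -/
theorem sum_sq_edgeExpectation_pauli_le (hn : 2 ≤ n) {ρ : NetworkOp (LadderVertex n)}
    (hρ : ρ.PosSemidef) :
    ∑ e : LadderEdge n, ∑ k : Role n → Fin 2,
      edgeExpectation ρ e (fun r => pauli (k r)) ^ 2 ≤ 2 ^ (n - 1) * ρ.trace.re ^ 2 := by
  set M : Fin 2 → ℝ := fun t => ∑ p, ∑ α, (ρ (config 0 (fun r => r.elim t α) p)
        (config 0 (fun r => r.elim t α) p)).re with hM
  have htr : ρ.trace.re = M 0 + M 1 := by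
    rw [Matrix.trace, Complex.re_sum, ← (configEquiv 0).sum_comp, Fintype.sum_prod_type,
      sum_role_config, Fin.sum_univ_two, hM]
    simp only
    congr 1 <;> exact Finset.sum_comm
  have h : ∑ e : LadderEdge n, ∑ s, ‖coherence ρ e s‖ ^ 2 ≤ M 0 * M 1 + M 1 * M 0 := by
    simp only [sum_role_config, Fin.sum_univ_two, Finset.sum_add_distrib]
    rw [← Fintype.sum_prod_type' (f := fun e σ => ‖coherence ρ e fun r => r.elim 0 σ‖ ^ 2),
      ← Fintype.sum_prod_type' (f := fun e σ => ‖coherence ρ e fun r => r.elim 1 σ‖ ^ 2)]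
    exact add_le_add (sum_sq_coherence_le hρ 0) (sum_sq_coherence_le hρ 1)
  simp only [sum_sq_edgeExpectation_pauli hn hρ.1, ← Finset.mul_sum]
  rw [htr]
  have h2 : (2 : ℝ) ^ n = 2 ^ (n - 1) * 2 := by
    rw [← pow_succ, Nat.sub_add_cancel (by omega)]
  rw [h2, mul_assoc]
  gcongr
  nlinarith [sq_nonneg (M 0 - M 1)]

end Bound

/-! ### The trade-off for Bell inequalities -/

section Bell

/-- Every Walsh coefficient of a normalized Bell expression is, up to a sign, the value of a local
deterministic strategy; the sign is absorbed by the outcomes of one role `r₀`. -/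
theorem IsNormalizedBell.sq_walsh_le {R : Type} [Fintype R] [DecidableEq R] (r₀ : R)
    {c : (R → Fin 2) → ℝ} (hc : IsNormalizedBell c) (k : R → Fin 2) :
    (∑ x, c x * ∏ r, ((walsh (x r) (k r) : ℤ) : ℝ)) ^ 2 ≤ 1 := by
  have h1 : ∑ x, c x * ∏ r, ((walsh (x r) (k r) : ℤ) : ℝ) ≤ 1 :=
    hc.2 ⟨fun r x => walsh x (k r), rfl⟩
  have h2 : -∑ x, c x * ∏ r, ((walsh (x r) (k r) : ℤ) : ℝ) ≤ 1 := by
    refine hc.2 ⟨fun r x => (if r = r₀ then -1 else 1) * walsh x (k r), ?_⟩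
    have hs : ∏ r, (((if r = r₀ then -1 else 1 : ℤˣ) : ℤ) : ℝ) = -1 := by
      rw [Finset.prod_eq_single r₀] <;> simp +contextual
    simp only [localValue, Units.val_mul, Int.cast_mul, Finset.prod_mul_distrib, hs]
    simp
  rw [sq_le_one_iff_abs_le_one, abs_le]
  constructor <;> linarith

variable {n : ℕ}

/-- In terms of planar observables, a normalized Bell expression is a linear form in the correlation
tensor whose coefficient vector has norm at most one. -/
theorem sq_bellValue_planar_le {c : (Role n → Fin 2) → ℝ} (hc : IsNormalizedBell c)
    (ρ : NetworkOp (LadderVertex n)) {q : LadderVertex n → Fin 2 → ℝ}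
    (hq : ∀ v, ∑ k, q v k ^ 2 = 1) (e : LadderEdge n) :
    bellValue c ρ (fun v => planarObservable (q v)) e ^ 2 ≤
      ∑ k : Role n → Fin 2, edgeExpectation ρ e (fun r => pauli (k r)) ^ 2 := by
  have h : bellValue c ρ (fun v => planarObservable (q v)) e =
      ∑ k : Role n → Fin 2, (∏ r, q (e.player r) (k r)) *
        (∑ x, c x * ∏ r, ((walsh (x r) (k r) : ℤ) : ℝ)) *
        edgeExpectation ρ e fun r => pauli (k r) := by
    simp only [bellValue, planarObservable]
    simp_rw [fun x : Role n → Fin 2 => edgeExpectation_sum_smul ρ e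
      (fun r k => ((walsh (x r) k : ℤ) : ℝ) * q (e.player r) k) pauli, Finset.mul_sum]
    rw [Finset.sum_comm]
    refine Finset.sum_congr rfl fun k _ => ?_
    rw [Finset.sum_mul]
    refine Finset.sum_congr rfl fun x _ => ?_
    rw [Finset.prod_mul_distrib]; ring
  rw [h]
  refine (Finset.sum_mul_sq_le_sq_mul_sq _ _ _).trans ?_
  refine mul_le_of_le_one_left (Finset.sum_nonneg fun _ _ => sq_nonneg _) ?_
  calc _ ≤ ∑ k : Role n → Fin 2, ∏ r, q (e.player r) (k r) ^ 2 := by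
        refine Finset.sum_le_sum fun k _ => ?_
        rw [mul_pow, Finset.prod_pow]
        exact mul_le_of_le_one_right (sq_nonneg _) (hc.sq_walsh_le none k)
    _ = 1 := by
        rw [← Fintype.piFinset_univ, ← Finset.prod_univ_sum (fun _ => Finset.univ)
          (fun r k => q (e.player r) k ^ 2)]
        simp [hq]

theorem sum_sq_bellValue_le (hn : 2 ≤ n) {c : (Role n → Fin 2) → ℝ} (hc : IsNormalizedBell c)
    {ρ : NetworkOp (LadderVertex n)} (hρ : IsDensityOp ρ)
    {A : LadderVertex n → Fin 2 → QubitOp} (hA : ∀ v x, IsBinaryObservable (A v x)) :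
    ∑ e : LadderEdge n, bellValue c ρ A e ^ 2 ≤ 2 ^ (n - 1) := by
  choose K q hq hK hKA using fun v => exists_kraus_planar (hA v)
  set L : (LadderVertex n → Fin 2) → NetworkOp (LadderVertex n) :=
    fun b => tensorOp fun v => K v (b v) with hL
  set σ : (LadderVertex n → Fin 2) → NetworkOp (LadderVertex n) :=
    fun b => L b * ρ * (L b).conjTranspose with hσ
  have hσpos : ∀ b, (σ b).PosSemidef := fun b => hρ.1.mul_mul_conjTranspose_same _
  have hσtr : ∑ b, (σ b).trace.re = 1 := by
    rw [← Complex.re_sum, trace_kraus K hK ρ, hρ.2, Complex.one_re]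
  have hbell : ∀ e, bellValue c ρ A e =
      ∑ b, bellValue c (σ b) (fun v => planarObservable (q v (b v))) e := by
    intro e
    simp only [bellValue]
    rw [Finset.sum_comm]
    refine Finset.sum_congr rfl fun x _ => ?_
    rw [← Finset.mul_sum, edgeExpectation_kraus K hK ρ e _
      (fun r b => planarObservable (q (e.player r) b) (x r)) fun r => hKA _ _]
  have hb : ∀ b, √(∑ e, bellValue c (σ b) (fun v => planarObservable (q v (b v))) e ^ 2) ≤
      √(2 ^ (n - 1)) * (σ b).trace.re := by
    intro b
    have htr : 0 ≤ (σ b).trace.re := (Complex.le_def.1 (hσpos b).trace_nonneg).1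
    rw [← Real.sqrt_sq htr, ← Real.sqrt_mul (by positivity)]
    refine Real.sqrt_le_sqrt (le_trans ?_ (sum_sq_edgeExpectation_pauli_le hn (hσpos b)))
    exact Finset.sum_le_sum fun e _ => sq_bellValue_planar_le hc _ (fun v => hq v (b v)) e
  rw [← Real.sqrt_le_sqrt_iff (by positivity)]
  simp only [hbell]
  calc _ ≤ ∑ b, √(∑ e, bellValue c (σ b) (fun v => planarObservable (q v (b v))) e ^ 2) :=
        sqrt_sum_sq_sum_le _ _
    _ ≤ ∑ b, √(2 ^ (n - 1)) * (σ b).trace.re := Finset.sum_le_sum fun b _ => hb b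
    _ = √(2 ^ (n - 1)) := by rw [← Finset.mul_sum, hσtr, mul_one]

/-- An optimal local deterministic strategy, realized on the product state `|0…0⟩` by the
observables `±σ_z`, gives the local bound on every hyperedge. -/
theorem exists_sum_sq_bellValue_eq {c : (Role n → Fin 2) → ℝ} (hc : IsNormalizedBell c) :
    ∃ (ρ : NetworkOp (LadderVertex n)) (A : LadderVertex n → Fin 2 → QubitOp),
      IsDensityOp ρ ∧ (∀ v x, IsBinaryObservable (A v x)) ∧
        ∑ e : LadderEdge n, bellValue c ρ A e ^ 2 = 2 ^ (n - 1) := by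
  obtain ⟨a, ha⟩ := hc.1
  set Z : ℤˣ → QubitOp := fun s => !![((s : ℤ) : ℂ), 0; 0, -((s : ℤ) : ℂ)] with hZ
  set role : LadderVertex n → Role n := Option.map Prod.fst with hrole
  have hrp : ∀ (e : LadderEdge n) r, role (e.player r) = r := by
    intro e r; cases r <;> rfl
  refine ⟨Matrix.single 0 0 1, fun v x => Z (a (role v) x), ⟨?_, ?_⟩, fun v x => ⟨?_, ?_⟩, ?_⟩
  · have : (Matrix.single 0 0 1 : NetworkOp (LadderVertex n)) =
        Matrix.vecMulVec (Pi.single 0 1) (star (Pi.single 0 1)) := by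
      rw [Pi.star_single, star_one, Matrix.single_eq_single_vecMulVec_single]
    rw [this]
    exact Matrix.posSemidef_vecMulVec_self_star _
  · simp
  · ext i j
    fin_cases i <;> fin_cases j <;> simp [hZ, Matrix.conjTranspose_apply]
  · have : ∀ s : ℤˣ, Z s * Z s = 1 := by
      intro s
      rcases Int.units_eq_one_or s with h | h <;> ext i j <;> fin_cases i <;> fin_cases j <;>
        simp [hZ, h]
    exact this _
  · have h : ∀ e : LadderEdge n, bellValue c (Matrix.single 0 0 1)
        (fun v x => Z (a (role v) x)) e = 1 := by
      intro e
      rw [← ha, bellValue, localValue]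
      refine Finset.sum_congr rfl fun x _ => ?_
      rw [edgeExpectation, Matrix.trace_single_mul, tensorOp_edgeFactor_apply]
      simp only [hrp]
      have hp : ∀ r, Z (a r (x r)) 0 0 = ((a r (x r) : ℤ) : ℂ) := fun r => rfl
      simp only [Pi.zero_apply, hp, ← Int.cast_prod, if_true, Finset.prod_const_one, mul_one,
        one_smul, Complex.intCast_re]
    simp [h]

end Bell

/-! ### Tightness for correlation tensors -/

section Tensor

variable {n : ℕ}

theorem edgeExpectation_unitary {U : LadderVertex n → QubitOp}
    (hU : ∀ v, U v * (U v).conjTranspose = 1) (ρ : NetworkOp (LadderVertex n))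
    (e : LadderEdge n) (B : Role n → QubitOp) :
    edgeExpectation ρ e (fun r => U (e.player r) * B r * (U (e.player r)).conjTranspose) =
      edgeExpectation ((tensorOp U).conjTranspose * ρ * tensorOp U) e B := by
  rw [edgeExpectation_kraus (β := Unit) (fun v _ => (U v).conjTranspose) (by simpa using hU) ρ e _
    (fun r _ => B r) (by simp), Fintype.sum_unique, ← conjTranspose_tensorOp,
    Matrix.conjTranspose_conjTranspose]

theorem coherence_add_one {ρ : NetworkOp (LadderVertex n)} (hρ : ρ.IsHermitian)
    (e : LadderEdge n) (s : Role n → Fin 2) :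
    coherence ρ e (s + 1) = star (coherence ρ e s) := by
  have h : ∀ x : Fin 2, x + 1 + 1 = x := by decide
  have hs : s + 1 + 1 = s := funext fun r => h _
  rw [coherence, coherence, star_sum, hs,
    ← Equiv.sum_comp (Equiv.addRight (1 : Fin (n - 1) → Fin 2))]
  refine Finset.sum_congr rfl fun p _ => ?_
  have hp : p + 1 + 1 = p := funext fun r => h _
  simp only [Equiv.coe_addRight, hp]
  exact (hρ.apply _ _).symm

/-- The Greenberger–Horne–Zeilinger state of the first copies of all roles, the second copies being
in the state `|0⟩`. -/
noncomputable def ghzState (n : ℕ) : NetworkOp (LadderVertex n) :=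
  (2⁻¹ : ℝ) • Matrix.vecMulVec (Pi.single 0 1 + Pi.single (config 0 1 1) 1)
    (star (Pi.single 0 1 + Pi.single (config 0 1 1) 1))

theorem config_one_ne_zero : config (n := n) 0 1 1 ≠ 0 := fun h =>
  one_ne_zero (congrFun h none)

theorem isDensityOp_ghzState : IsDensityOp (ghzState n) := by
  constructor
  · exact (Matrix.posSemidef_vecMulVec_self_star _).smul (by norm_num)
  · have h := config_one_ne_zero (n := n)
    simp [ghzState, Matrix.trace_vecMulVec, h, h.symm]
    norm_num

theorem coherence_ghzState_zero : coherence (ghzState n) 0 0 = 2⁻¹ := by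
  have h0 : config (n := n) 0 0 0 = 0 := by
    funext v
    rcases v with _ | ⟨i, j⟩ <;> simp [config]
  rw [coherence, Finset.sum_eq_single 0]
  · simp [h0, ghzState, Matrix.vecMulVec_apply, config_one_ne_zero, config_one_ne_zero.symm]
  · intro p _ hp
    have h1 : config (n := n) 0 0 p ≠ 0 := fun h => hp <| by
      simpa [h0] using (configEquiv 0).injective (a₁ := (0, p)) (a₂ := (0, 0)) (h.trans h0.symm)
    have h2 : config (n := n) 0 0 p ≠ config 0 1 1 := fun h =>
      zero_ne_one (congrFun h none)
    simp [ghzState, Matrix.vecMulVec_apply, h1, h2]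
  · simp

theorem le_sum_sq_coherence_ghzState :
    2⁻¹ ≤ ∑ s, ‖coherence (ghzState n) 0 s‖ ^ 2 := by
  have hne : (0 : Role n → Fin 2) ≠ 1 := fun h => zero_ne_one (congrFun h none)
  have h1 : coherence (ghzState n) 0 1 = 2⁻¹ := by
    have h := coherence_add_one (isDensityOp_ghzState (n := n)).1.1 0 0
    rwa [zero_add, coherence_ghzState_zero, star_inv₀, star_ofNat] at h
  calc (2⁻¹ : ℝ) = ∑ s ∈ {0, 1}, ‖coherence (ghzState n) 0 s‖ ^ 2 := by
        rw [Finset.sum_pair hne, coherence_ghzState_zero, h1]; norm_num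
    _ ≤ _ := Finset.sum_le_sum_of_subset_of_nonneg (Finset.subset_univ _) fun _ _ _ => sq_nonneg _

variable {o : LadderVertex n → Fin 2 → EuclideanSpace ℝ (Fin 3)}

theorem sum_correlationSq_le (hn : 2 ≤ n) (ho : ∀ v, Orthonormal ℝ (o v))
    {ρ : NetworkOp (LadderVertex n)} (hρ : IsDensityOp ρ) :
    ∑ e : LadderEdge n, correlationSq ρ o e ≤ 2 ^ (n - 1) := by
  choose U hU1 hU2 hU using fun v => exists_unitary_spinObservable (ho v)
  have h := sum_sq_edgeExpectation_pauli_le hn (hρ.1.conjTranspose_mul_mul_same (tensorOp U))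
  have htr : ((tensorOp U).conjTranspose * ρ * tensorOp U).trace = 1 := by
    rw [Matrix.trace_mul_comm, ← mul_assoc, conjTranspose_tensorOp, tensorOp_mul]
    simp only [hU2, tensorOp_one, one_mul, hρ.2]
  rw [htr] at h
  simpa [correlationSq, hU, edgeExpectation_unitary hU2] using h

theorem exists_sum_correlationSq_eq (hn : 2 ≤ n) (ho : ∀ v, Orthonormal ℝ (o v)) :
    ∃ ρ : NetworkOp (LadderVertex n), IsDensityOp ρ ∧
        ∑ e : LadderEdge n, correlationSq ρ o e = 2 ^ (n - 1) := by
  choose U hU1 hU2 hU using fun v => exists_unitary_spinObservable (ho v)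
  have hUU : (tensorOp U).conjTranspose * tensorOp U = 1 := by
    rw [conjTranspose_tensorOp, tensorOp_mul]
    simp only [hU1, tensorOp_one]
  set ρ := tensorOp U * ghzState n * (tensorOp U).conjTranspose with hρ
  have hback : (tensorOp U).conjTranspose * ρ * tensorOp U = ghzState n := by
    calc _ = ((tensorOp U).conjTranspose * tensorOp U) * ghzState n *
          ((tensorOp U).conjTranspose * tensorOp U) := by simp only [hρ, mul_assoc]
      _ = _ := by rw [hUU, one_mul, mul_one]
  have hdens : IsDensityOp ρ := by
    refine ⟨isDensityOp_ghzState.1.mul_mul_conjTranspose_same _, ?_⟩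
    rw [hρ, Matrix.trace_mul_comm, ← mul_assoc, hUU, one_mul, isDensityOp_ghzState.2]
  refine ⟨ρ, hdens, le_antisymm (sum_correlationSq_le hn ho hdens) ?_⟩
  have h0 : (2 : ℝ) ^ (n - 1) ≤ correlationSq ρ o 0 := by
    simp only [correlationSq, hU, edgeExpectation_unitary hU2, hback]
    rw [sum_sq_edgeExpectation_pauli hn isDensityOp_ghzState.1.1]
    have h2 : (2 : ℝ) ^ (n - 1) = 2 ^ n * 2⁻¹ := by
      rw [← div_eq_mul_inv, eq_div_iff two_ne_zero, ← pow_succ, Nat.sub_add_cancel (by omega)]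
    rw [h2]
    gcongr
    exact le_sum_sq_coherence_ghzState
  exact h0.trans (Finset.single_le_sum (f := fun e => correlationSq ρ o e)
    (fun e _ => Finset.sum_nonneg fun _ _ => sq_nonneg _) (Finset.mem_univ 0))

end Tensor

theorem mainTheorem1 (n : ℕ) (hn : 2 ≤ n) :
    -- every normalized full-correlation Bell inequality obeys the trade-off relation, tightly
    (∀ c : (Role n → Fin 2) → ℝ, IsNormalizedBell c →
      (∀ (ρ : NetworkOp (LadderVertex n)) (A : LadderVertex n → Fin 2 → QubitOp),
        IsDensityOp ρ → (∀ v x, IsBinaryObservable (A v x)) →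
          ∑ e : LadderEdge n, bellValue c ρ A e ^ 2 ≤ 2 ^ (n - 1)) ∧
      ∃ (ρ : NetworkOp (LadderVertex n)) (A : LadderVertex n → Fin 2 → QubitOp),
        IsDensityOp ρ ∧ (∀ v x, IsBinaryObservable (A v x)) ∧
          ∑ e : LadderEdge n, bellValue c ρ A e ^ 2 = 2 ^ (n - 1)) ∧
    -- the same for the squared Bell parameter given by the correlation tensor in local planes
    (∀ o : LadderVertex n → Fin 2 → EuclideanSpace ℝ (Fin 3), (∀ v, Orthonormal ℝ (o v)) →
      (∀ ρ : NetworkOp (LadderVertex n), IsDensityOp ρ →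
        ∑ e : LadderEdge n, correlationSq ρ o e ≤ 2 ^ (n - 1)) ∧
      ∃ ρ : NetworkOp (LadderVertex n), IsDensityOp ρ ∧
        ∑ e : LadderEdge n, correlationSq ρ o e = 2 ^ (n - 1)) :=
  ⟨fun _ hc => ⟨fun _ _ hρ hA => sum_sq_bellValue_le hn hc hρ hA, exists_sum_sq_bellValue_eq hc⟩,
    fun _ ho => ⟨fun _ hρ => sum_correlationSq_le hn ho hρ, exists_sum_correlationSq_eq hn ho⟩⟩
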